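/- All normed spaces are real. For subsets $K,B$ of a normed space $X$, with $B$ convex, symmetric about the origin and with non-empty interior, let $M(K,B)\in\mathbb N\cup\{\infty\}$ be the packing number, that is, the supremum of the cardinalities of sets $S\subseteq K$ such that the translates $x+\operatorname{int}B$, $x\in S$, are pairwise disjoint, and let $$\hat M(K,B)=\sup\bigl\{N:\ \exists\,x_1,\dots,x_N\in K\ \text{ with }\ (x_j+\operatorname{int}B)\cap\operatorname{conv}\{x_i:i<j\}=\emptyset\ \text{ for all } j\bigr\}.$$ Logarithms are to the base $2$, with $\log 0=-\infty$ and $\log\infty=\infty$. Let $K(X)\in[0,\infty]$ be the $K$-convexity constant of $X$, that is, the supremum over $n$ of the norms of the Rademacher projections $f\mapsto\sum_{i=1}^n\varepsilon_i\,\mathbb E_\delta[\delta_i f(\delta)]$ on $L_2(\{-1,1\}^n;X)$, where $\{-1,1\}^n$ carries the uniform probability measure; $X$ is $K$-convex if $K(X)<\infty$. **Theorem.** Let $X$ be a $K$-convex normed space with $K(X)\le\kappa<\infty$ and closed unit ball $B$. Then for every bounded set $T\subset X$, $$\log M(T,B)\le\beta\,\log\hat M(T,B/2),$$ where $\beta\in(0,\infty)$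 depends only on $\kappa$ and on the diameter of $T$. Likewise, if $r>0$ and $U\subset X$ is a convex set, symmetric about the origin, with $U\supseteq rB$, then $$\log M(B,U)\le\beta'\,\log\hat M(B,U/2),$$ where $\beta'\in(0,\infty)$ depends only on $\kappa$ and $r$. -/

import Mathlib

open scoped NNReal ENNReal Pointwise

universe u

noncomputable section

/-- The packing number `M(K, B)` in `ℕ∞`: the supremum of the cardinalities of the sets `S ⊆ K`
such that the translates `x + int B`, `x ∈ S`, are pairwise disjoint. -/
def packNum {X : Type*} [NormedAddCommGroup X] (K B : Set X) : ℕ∞ :=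
  ⨆ (S : Set X) (_ : S ⊆ K) (_ : S.PairwiseDisjoint fun x => x +ᵥ interior B), S.encard

/-- A finite sequence `x₁, …, x_N` is `B`-convexly separated if `x_j + int B` does not meet the
convex hull of the earlier points `x_i`, `i < j`, for every `j`. -/
def IsConvexlySeparated {X : Type*} [NormedAddCommGroup X] [NormedSpace ℝ X] (B : Set X)
    {N : ℕ} (x : Fin N → X) : Prop :=
  ∀ j, (x j +ᵥ interior B) ∩ convexHull ℝ {y | ∃ i < j, y = x i} = ∅

/-- The convexified packing number `M̂(K, B)` in `ℕ∞`: the supremum of the lengths of the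
`B`-convexly separated sequences in `K`. -/
def convPackNum {X : Type*} [NormedAddCommGroup X] [NormedSpace ℝ X] (K B : Set X) : ℕ∞ :=
  ⨆ (N : ℕ) (_ : ∃ x : Fin N → X, (∀ j, x j ∈ K) ∧ IsConvexlySeparated B x), (N : ℕ∞)

/-- The logarithm to the base 2 on `ℕ∞`, with values in `[-∞, ∞]`: `log 0 = -∞`, `log ∞ = ∞`. -/
def log₂ (n : ℕ∞) : EReal :=
  ENNReal.log (n : ℝ≥0∞) / ((Real.log 2 : ℝ) : EReal)

/-- The norm of `L₂({-1,1}ⁿ; X)`, for the uniform probability measure on `{-1,1}ⁿ`. -/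
def cubeL2Norm {X : Type*} [NormedAddCommGroup X] {n : ℕ} (f : (Fin n → ℤˣ) → X) : ℝ :=
  √((2 ^ n : ℝ)⁻¹ * ∑ ε, ‖f ε‖ ^ 2)

/-- The Rademacher projection on `L₂({-1,1}ⁿ; X)`: `(R f)(ε) = ∑ᵢ εᵢ 𝔼_δ[δᵢ f(δ)]`. -/
def rademacherProj {X : Type*} [NormedAddCommGroup X] [NormedSpace ℝ X] {n : ℕ}
    (f : (Fin n → ℤˣ) → X) (ε : Fin n → ℤˣ) : X :=
  ∑ i, ((ε i : ℤ) : ℝ) • ((2 ^ n : ℝ)⁻¹ • ∑ δ : Fin n → ℤˣ, ((δ i : ℤ) : ℝ) • f δ)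

/-- The `K`-convexity constant `K(X)` in `[0, ∞]`: the supremum over `n` of the operator norms of
the Rademacher projections on `L₂({-1,1}ⁿ; X)`, written as the least common bound
(`∞` if there is none). `X` is `K`-convex when it is finite. -/
def kConvexityConst (X : Type*) [NormedAddCommGroup X] [NormedSpace ℝ X] : ℝ≥0∞ :=
  ⨅ (C : ℝ≥0) (_ : ∀ (n : ℕ) (f : (Fin n → ℤˣ) → X),
    cubeL2Norm (rademacherProj f) ≤ C * cubeL2Norm f), (C : ℝ≥0∞)

end

/-! If `M̂(K, U/2) = N` is finite, a longest separated sequence `x` is maximal: each `a + int(U/2)`,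
`a ∈ K`, meets `conv x`. By a Maurey-type approximation, points of `conv x` lie within `U/2` of
averages of `2^s` of the `x_i`, with `s` depending only on `κ`, the diameter and `r`. So `a + int U`
contains such an average, disjoint translates get different index tuples, and `M ≤ N^(2^s)`; thus `β
= 2^s`.

The approximation repeatedly halves a long dyadic average, keeping one point of each pair. The error
is a signed average of differences, so summability needs signs with `‖∑ ±x_i‖ ≤ A ρ^t 2^t D` for
`2^t` vectors, `ρ < 1`. Block signing (`SignedSumBound.mul`) reduces this to a gain below 1 at one
size. K-convexity gives the gain: if all signed sums of unit-ball vectors indexed by `{-1,1}^n` were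
nearly maximal, they would behave like an `ℓ₁` basis, and the Rademacher projection of `ω ↦ x ω`
would have norm about `𝔼|∑ ω_i|`, of order `√n`. -/

/-! ### Moments of Rademacher sums -/

/-- A sum over the cube `{-1,1}ⁿ⁺¹` of a function of `∑ᵢ ωᵢ`, split along the first coordinate. -/
lemma sum_cube_succ (n : ℕ) (F : ℝ → ℝ) :
    ∑ ω : Fin (n + 1) → ℤˣ, F (∑ i, ((ω i : ℤ) : ℝ)) =
      ∑ ω : Fin n → ℤˣ, (F (1 + ∑ i, ((ω i : ℤ) : ℝ)) + F (-1 + ∑ i, ((ω i : ℤ) : ℝ))) := by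
  rw [← (Fin.consEquiv fun _ : Fin (n + 1) => ℤˣ).sum_comp, Fintype.sum_prod_type,
    Finset.sum_add_distrib]
  have hU : (Finset.univ : Finset ℤˣ) = {1, -1} := rfl
  rw [hU, Finset.sum_pair (by decide)]
  simp [Fin.consEquiv, Fin.sum_univ_succ]

lemma card_cube (n : ℕ) : Fintype.card (Fin n → ℤˣ) = 2 ^ n := by
  simp

lemma sum_cube_sq (n : ℕ) :
    ∑ ω : Fin n → ℤˣ, (∑ i, ((ω i : ℤ) : ℝ)) ^ 2 = n * 2 ^ n := by
  induction n with
  | zero => simp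
  | succ n ih =>
    rw [sum_cube_succ n fun s => s ^ 2]
    have : ∀ s : ℝ, (1 + s) ^ 2 + (-1 + s) ^ 2 = 2 * s ^ 2 + 2 := fun s => by ring
    simp only [this, Finset.sum_add_distrib, ← Finset.mul_sum, ih, Finset.sum_const,
      Finset.card_univ, card_cube, nsmul_eq_mul]
    push_cast
    ring

lemma sum_cube_pow_four (n : ℕ) :
    ∑ ω : Fin n → ℤˣ, (∑ i, ((ω i : ℤ) : ℝ)) ^ 4 = (3 * n ^ 2 - 2 * n) * 2 ^ n := by
  induction n with
  | zero => simp
  | succ n ih =>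
    rw [sum_cube_succ n fun s => s ^ 4]
    have : ∀ s : ℝ, (1 + s) ^ 4 + (-1 + s) ^ 4 = 2 * s ^ 4 + 12 * s ^ 2 + 2 := fun s => by ring
    simp only [this, Finset.sum_add_distrib, ← Finset.mul_sum, ih, sum_cube_sq, Finset.sum_const,
      Finset.card_univ, card_cube, nsmul_eq_mul]
    push_cast
    ring

/-- The even quartic on the left touches `|s|` at `|s| = t`, so second and fourth moments bound the
first from below. -/
lemma three_halves_mul_sq_sub_le_abs {t : ℝ} (ht : 0 < t) (s : ℝ) :
    3 / 2 * s ^ 2 / t - 1 / 2 * s ^ 4 / t ^ 3 ≤ |s| := by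
  obtain ⟨v, hv, hsv⟩ : ∃ v, 0 ≤ v ∧ |s| = t * v :=
    ⟨|s| / t, by positivity, by field_simp⟩
  have h2 : s ^ 2 = (t * v) ^ 2 := by rw [← hsv, sq_abs]
  have h4 : s ^ 4 = (t * v) ^ 4 := by rw [show s ^ 4 = (s ^ 2) ^ 2 by ring, h2]; ring
  rw [h2, h4, hsv]
  have : 3 / 2 * (t * v) ^ 2 / t - 1 / 2 * (t * v) ^ 4 / t ^ 3
      = t * v * (1 - (v - 1) ^ 2 * (v + 2) / 2) := by
    field_simp
    ring
  rw [this]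
  have : 0 ≤ t * v * ((v - 1) ^ 2 * (v + 2) / 2) := by positivity
  linarith

/-- A first moment bound: the sum of `3k²` independent signs has mean absolute value at
least `k`. -/
lemma le_sum_cube_abs {k : ℕ} (hk : 0 < k) :
    (k : ℝ) * 2 ^ (3 * k ^ 2) ≤ ∑ ω : Fin (3 * k ^ 2) → ℤˣ, |∑ i, ((ω i : ℤ) : ℝ)| := by
  have hk' : (0 : ℝ) < k := by exact_mod_cast hk
  -- With `n = 3k²` terms, `t = 3k = √(3n)` is nearly the optimal `√(𝔼s⁴/𝔼s²)`.
  have h := Finset.sum_le_sum fun (ω : Fin (3 * k ^ 2) → ℤˣ) (_ : ω ∈ Finset.univ) =>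
    three_halves_mul_sq_sub_le_abs (t := 3 * k) (by positivity) (∑ i, ((ω i : ℤ) : ℝ))
  refine le_trans ?_ h
  rw [Finset.sum_sub_distrib, ← Finset.sum_div, ← Finset.sum_div, ← Finset.mul_sum,
    ← Finset.mul_sum, sum_cube_sq, sum_cube_pow_four]
  push_cast
  have : (3 / 2 * (3 * (k : ℝ) ^ 2 * 2 ^ (3 * k ^ 2)) / (3 * k) -
      1 / 2 * ((3 * (3 * (k : ℝ) ^ 2) ^ 2 - 2 * (3 * k ^ 2)) * 2 ^ (3 * k ^ 2)) / (3 * k) ^ 3)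
      = k * 2 ^ (3 * k ^ 2) + 2 ^ (3 * k ^ 2) / (9 * k) := by
    field_simp
    ring
  rw [this]
  have : (0 : ℝ) ≤ 2 ^ (3 * k ^ 2) / (9 * k) := by positivity
  linarith

/-- The previous bound for a sum twisted by fixed signs. -/
lemma le_sum_cube_abs_twist {k : ℕ} (hk : 0 < k) (ε : Fin (3 * k ^ 2) → ℤˣ) :
    (k : ℝ) * 2 ^ (3 * k ^ 2) ≤
      ∑ ω : Fin (3 * k ^ 2) → ℤˣ, |∑ i, ((ε i : ℤ) : ℝ) * ((ω i : ℤ) : ℝ)| := by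
  refine (le_sum_cube_abs hk).trans_eq ?_
  rw [← Equiv.sum_comp (Equiv.mulLeft ε) fun ω : Fin (3 * k ^ 2) → ℤˣ => |∑ i, ((ω i : ℤ) : ℝ)|]
  simp

/-! ### Signed sums in a `K`-convex space -/

lemma cubeL2Norm_le {X : Type*} [NormedAddCommGroup X] {n : ℕ} {f : (Fin n → ℤˣ) → X} {L : ℝ}
    (hL : 0 ≤ L) (h : ∀ ε, ‖f ε‖ ≤ L) : cubeL2Norm f ≤ L := by
  refine Real.sqrt_le_iff.2 ⟨hL, ?_⟩
  rw [inv_mul_le_iff₀ (by positivity)]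
  refine (Finset.sum_le_sum fun ε _ => pow_le_pow_left₀ (norm_nonneg _) (h ε) 2).trans_eq ?_
  simp

lemma le_cubeL2Norm {X : Type*} [NormedAddCommGroup X] {n : ℕ} {f : (Fin n → ℤˣ) → X} {L : ℝ}
    (hL : 0 ≤ L) (h : ∀ ε, L ≤ ‖f ε‖) : L ≤ cubeL2Norm f := by
  refine Real.le_sqrt_of_sq_le ?_
  rw [le_inv_mul_iff₀ (by positivity)]
  refine le_trans (le_of_eq ?_)
    (Finset.sum_le_sum fun ε _ => pow_le_pow_left₀ hL (h ε) 2)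
  simp

section

variable {X : Type*} [NormedAddCommGroup X] [NormedSpace ℝ X]

/-- If `x` is a family in the unit ball all of whose signed sums are almost as long as possible,
then all its linear combinations are almost as long as possible. -/
lemma sum_abs_sub_le_norm_sum {ι : Type*} [Fintype ι] {x : ι → X} (hx : ∀ i, ‖x i‖ ≤ 1) {δ : ℝ}
    (h : ∀ s : ι → ℝ, (∀ i, |s i| = 1) → Fintype.card ι - δ ≤ ‖∑ i, s i • x i‖)
    {c : ι → ℝ} {M : ℝ} (hM : 0 ≤ M) (hc : ∀ i, |c i| ≤ M) :
    ∑ i, |c i| - M * δ ≤ ‖∑ i, c i • x i‖ := by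
  set s : ι → ℝ := fun i => if 0 ≤ c i then 1 else -1 with hs
  have hs1 : ∀ i, |s i| = 1 := fun i => by simp only [hs]; split_ifs <;> simp
  have hsc : ∀ i, s i * |c i| = c i := fun i => by
    simp only [hs]
    split_ifs with h0
    · simp [abs_of_nonneg h0]
    · simp [abs_of_neg (not_le.1 h0)]
  -- The full signed sum, scaled by `M`, exceeds the desired combination by a remainder whose norm
  -- is at most `∑ (M - |c i|)`.
  have hsplit : M • ∑ i, s i • x i = ∑ i, c i • x i + ∑ i, (s i * (M - |c i|)) • x i := by
    rw [Finset.smul_sum, ← Finset.sum_add_distrib]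
    refine Finset.sum_congr rfl fun i _ => ?_
    rw [smul_smul, ← add_smul]
    congr 1
    linear_combination hsc i
  have hrest : ‖∑ i, (s i * (M - |c i|)) • x i‖ ≤ Fintype.card ι * M - ∑ i, |c i| := by
    refine (norm_sum_le _ _).trans ?_
    have : (Fintype.card ι : ℝ) * M - ∑ i, |c i| = ∑ i, (M - |c i|) := by
      simp [Finset.sum_sub_distrib]
    rw [this]
    refine Finset.sum_le_sum fun i _ => ?_
    rw [norm_smul, norm_mul, Real.norm_eq_abs, hs1, one_mul, Real.norm_eq_abs,
      abs_of_nonneg (sub_nonneg.2 (hc i))]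
    exact mul_le_of_le_one_right (sub_nonneg.2 (hc i)) (hx i)
  have hnorm : ‖M • ∑ i, s i • x i‖ = M * ‖∑ i, s i • x i‖ := by
    rw [norm_smul, Real.norm_of_nonneg hM]
  have h1 := mul_le_mul_of_nonneg_left (h s hs1) hM
  have h2 := norm_add_le (∑ i, c i • x i) (∑ i, (s i * (M - |c i|)) • x i)
  rw [← hsplit, hnorm] at h2
  linarith

lemma rademacherProj_eq {n : ℕ} (f : (Fin n → ℤˣ) → X) (ε : Fin n → ℤˣ) :
    rademacherProj f ε =
      (2 ^ n : ℝ)⁻¹ • ∑ δ : Fin n → ℤˣ, (∑ i, ((ε i : ℤ) : ℝ) * ((δ i : ℤ) : ℝ)) • f δ := by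
  simp only [rademacherProj, Finset.sum_smul, mul_smul]
  rw [Finset.sum_comm, Finset.smul_sum]
  refine Finset.sum_congr rfl fun i _ => ?_
  rw [smul_comm, Finset.smul_sum]

/-- In a space whose Rademacher projections are bounded by `C`, the unit ball has no long
almost-isometric copy of the basis of `ℓ₁`. -/
lemma exists_signs_card_cube {C : ℝ}
    (hC : ∀ (n : ℕ) (f : (Fin n → ℤˣ) → X), cubeL2Norm (rademacherProj f) ≤ C * cubeL2Norm f)
    (hC0 : 0 ≤ C) {k : ℕ} (hk : C + 1 < k) {x : (Fin (3 * k ^ 2) → ℤˣ) → X}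
    (hx : ∀ ω, ‖x ω‖ ≤ 1) :
    ∃ s : (Fin (3 * k ^ 2) → ℤˣ) → ℝ, (∀ ω, |s ω| = 1) ∧
      ‖∑ ω, s ω • x ω‖ ≤ 2 ^ (3 * k ^ 2) - 1 / (3 * k ^ 2) := by
  by_contra! hcon
  have hkR : (0 : ℝ) < k := by linarith
  have hk0 : 0 < k := by exact_mod_cast hkR
  have hlow : ∀ ε, (k : ℝ) - 1 ≤ ‖rademacherProj x ε‖ := by
    intro ε
    -- The coefficients are at most `M = n`, so a deficit `1/n` costs only `1` in total.
    have h := sum_abs_sub_le_norm_sum hx (δ := 1 / (3 * k ^ 2))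
      (fun s hs => by
        rw [card_cube]
        push_cast
        exact (hcon s hs).le)
      (c := fun ω => ∑ i, ((ε i : ℤ) : ℝ) * ((ω i : ℤ) : ℝ)) (M := 3 * k ^ 2) (by positivity)
      (fun ω => by
        refine (Finset.abs_sum_le_sum_abs _ _).trans ?_
        have : ∀ i, |((ε i : ℤ) : ℝ) * ((ω i : ℤ) : ℝ)| = 1 := fun i => by
          rcases Int.units_eq_one_or (ε i) with h | h <;>
          rcases Int.units_eq_one_or (ω i) with h' | h' <;> simp [h, h']
        simp [this])
    have h1 := le_sum_cube_abs_twist hk0 ε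
    rw [mul_one_div_cancel (by positivity)] at h
    rw [rademacherProj_eq, norm_smul, norm_inv, norm_pow, Real.norm_ofNat,
      le_inv_mul_iff₀ (by positivity)]
    have h2 : (1 : ℝ) ≤ 2 ^ (3 * k ^ 2) := one_le_pow₀ (by norm_num)
    nlinarith
  have h1 := le_cubeL2Norm (by linarith) hlow
  have h2 := cubeL2Norm_le zero_le_one hx
  have h3 := hC _ x
  nlinarith

/-- Every family of `q` vectors of norm at most `D` has a signed sum of norm at most `b * q * D`. -/
def SignedSumBound (X : Type*) [NormedAddCommGroup X] [NormedSpace ℝ X] (q : ℕ) (b : ℝ) : Prop :=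
  ∀ (ι : Type) [Fintype ι], Fintype.card ι = q → ∀ (D : ℝ) (x : ι → X), (∀ i, ‖x i‖ ≤ D) →
    ∃ s : ι → ℝ, (∀ i, |s i| = 1) ∧ ‖∑ i, s i • x i‖ ≤ b * q * D

lemma SignedSumBound.one (q : ℕ) : SignedSumBound X q 1 := by
  intro ι _ hι D x hx
  refine ⟨fun _ => 1, by simp, ?_⟩
  refine (norm_sum_le_of_le _ fun i _ => (by simpa using hx i)).trans_eq ?_
  simp [hι]

/-- Sign within blocks of size `q'`, then sign the `q` block sums, each of norm at most `b' * q' *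
D`. -/
lemma SignedSumBound.mul {q q' : ℕ} {b b' : ℝ} (h : SignedSumBound X q b)
    (h' : SignedSumBound X q' b') : SignedSumBound X (q * q') (b * b') := by
  intro ι _ hι D x hx
  have e : ι ≃ Fin q × Fin q' := Fintype.equivOfCardEq (by simp [hι])
  have hblock : ∀ i : Fin q, ∃ s : Fin q' → ℝ, (∀ j, |s j| = 1) ∧
      ‖∑ j, s j • x (e.symm (i, j))‖ ≤ b' * q' * D := fun i =>
    h' (Fin q') (by simp) D _ fun j => hx _
  choose s hs hs' using hblock
  obtain ⟨t, ht, ht'⟩ := h (Fin q) (by simp) _ _ hs'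
  refine ⟨fun i => t (e i).1 * s (e i).1 (e i).2, fun i => by simp [abs_mul, hs, ht], ?_⟩
  rw [← e.symm.sum_comp, Fintype.sum_prod_type]
  simp only [Equiv.apply_symm_apply, mul_smul, ← Finset.smul_sum]
  refine ht'.trans_eq ?_
  push_cast
  ring

lemma SignedSumBound.pow {q : ℕ} {b : ℝ} (h : SignedSumBound X q b) (l : ℕ) :
    SignedSumBound X (q ^ l) (b ^ l) := by
  induction l with
  | zero => simpa using SignedSumBound.one (X := X) 1
  | succ l ih => simpa only [pow_succ] using ih.mul h

lemma SignedSumBound.mono {q : ℕ} {b b' : ℝ} (h : SignedSumBound X q b) (hb : b ≤ b') :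
    SignedSumBound X q b' := by
  intro ι _ hι D x hx
  obtain ⟨s, hs, hs'⟩ := h ι hι D x hx
  refine ⟨s, hs, hs'.trans ?_⟩
  rcases isEmpty_or_nonempty ι with hE | ⟨⟨i⟩⟩
  · simp [← hι]
  · have : 0 ≤ D := (norm_nonneg _).trans (hx i)
    gcongr

lemma signedSumBound_cube {C : ℝ}
    (hC : ∀ (n : ℕ) (f : (Fin n → ℤˣ) → X), cubeL2Norm (rademacherProj f) ≤ C * cubeL2Norm f)
    (hC0 : 0 ≤ C) {k : ℕ} (hk : C + 1 < k) :
    SignedSumBound X (2 ^ (3 * k ^ 2)) (1 - 1 / (3 * k ^ 2 * 2 ^ (3 * k ^ 2))) := by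
  intro ι _ hι D x hx
  have e : ι ≃ (Fin (3 * k ^ 2) → ℤˣ) := Fintype.equivOfCardEq (by rw [hι, card_cube])
  have hD : 0 ≤ D := (norm_nonneg _).trans (hx (e.symm 1))
  have hkR : (0 : ℝ) < k := by linarith
  rcases hD.eq_or_lt with rfl | hD
  · refine ⟨fun _ => 1, by simp, ?_⟩
    have : ∀ i, x i = 0 := fun i => norm_le_zero_iff.1 (hx i)
    simp [this]
  obtain ⟨s, hs, hs'⟩ := exists_signs_card_cube hC hC0 hk (x := fun ω => D⁻¹ • x (e.symm ω))
    (fun ω => by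
      rw [norm_smul, norm_inv, Real.norm_of_nonneg hD.le, inv_mul_le_iff₀ hD, mul_one]
      exact hx _)
  refine ⟨fun i => s (e i), fun i => hs _, ?_⟩
  rw [← e.symm.sum_comp]
  simp only [Equiv.apply_symm_apply]
  have : ∑ ω, s ω • D⁻¹ • x (e.symm ω) = D⁻¹ • ∑ ω, s ω • x (e.symm ω) := by
    rw [Finset.smul_sum]
    exact Finset.sum_congr rfl fun ω _ => smul_comm _ _ _
  rw [this, norm_smul, norm_inv, Real.norm_of_nonneg hD.le, inv_mul_le_iff₀ hD] at hs'
  refine hs'.trans_eq ?_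
  push_cast
  field_simp

/-- The bounds for blocks of one size give geometric decay along the powers of two. -/
lemma SignedSumBound.geometric {n : ℕ} {ρ : ℝ} (hn : 0 < n) (hρ0 : 0 < ρ) (hρ1 : ρ ≤ 1)
    (h : SignedSumBound X (2 ^ n) (ρ ^ n)) (t : ℕ) :
    SignedSumBound X (2 ^ t) ((ρ ^ n)⁻¹ * ρ ^ t) := by
  -- The leftover factor `2 ^ (t % n)` gets the trivial bound; this loses at most `ρ^(-n)`.
  have h1 := (SignedSumBound.one (X := X) (2 ^ (t % n))).mul (h.pow (t / n))
  rw [← pow_mul, ← pow_add, Nat.mod_add_div, one_mul, ← pow_mul] at h1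
  refine h1.mono ?_
  rw [le_inv_mul_iff₀ (by positivity), ← pow_add]
  refine pow_le_pow_of_le_one hρ0.le hρ1 ?_
  have := Nat.mod_add_div t n
  have := Nat.mod_lt t hn
  omega

end

/-- A `K`-convexity bound yields, uniformly over all spaces, geometric decay of minimal signed
averages. -/
lemma exists_signedSumBound (κ : ℝ≥0) :
    ∃ A ρ : ℝ, 0 < A ∧ 0 < ρ ∧ ρ < 1 ∧
      ∀ (X : Type u) [NormedAddCommGroup X] [NormedSpace ℝ X], kConvexityConst X ≤ κ →
        ∀ t, SignedSumBound X (2 ^ t) (A * ρ ^ t) := by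
  -- The second `+ 1` is slack: the infimum only yields an admissible `C < κ + 1`.
  obtain ⟨k, hk⟩ := exists_nat_gt ((κ : ℝ) + 1 + 1)
  have hk1 : (1 : ℝ) < k := by linarith [κ.2]
  have hk0 : 0 < k := by exact_mod_cast zero_lt_one.trans hk1
  set θ : ℝ := 1 - 1 / (3 * k ^ 2 * 2 ^ (3 * k ^ 2)) with hθ
  have hbig : (1 : ℝ) < 3 * k ^ 2 * 2 ^ (3 * k ^ 2) := by
    have h2 : (1 : ℝ) ≤ 2 ^ (3 * k ^ 2) := one_le_pow₀ (by norm_num)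
    have h3 : (1 : ℝ) < 3 * k ^ 2 := by nlinarith
    nlinarith
  have hθ0 : 0 < θ := by
    rw [hθ, sub_pos, div_lt_one (by linarith)]
    exact hbig
  have hθ1 : θ < 1 := by
    rw [hθ]
    exact sub_lt_self _ (by positivity)
  have hn : 0 < 3 * k ^ 2 := by positivity
  set ρ : ℝ := θ ^ (((3 * k ^ 2 : ℕ) : ℝ)⁻¹) with hρ
  have hρn : ρ ^ (3 * k ^ 2) = θ := Real.rpow_inv_natCast_pow hθ0.le hn.ne'
  have hρ0 : 0 < ρ := Real.rpow_pos_of_pos hθ0 _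
  have hρ1 : ρ < 1 := Real.rpow_lt_one hθ0.le hθ1 (by positivity)
  refine ⟨(ρ ^ (3 * k ^ 2))⁻¹, ρ, by positivity, hρ0, hρ1, ?_⟩
  intro X _ _ hX t
  have hlt : kConvexityConst X < ((κ + 1 : ℝ≥0) : ℝ≥0∞) :=
    hX.trans_lt (by exact_mod_cast lt_add_one κ)
  simp only [kConvexityConst, iInf_lt_iff] at hlt
  obtain ⟨C, hC, hCκ⟩ := hlt
  have hCκ' : (C : ℝ) < κ + 1 := by exact_mod_cast hCκ
  refine SignedSumBound.geometric hn hρ0 hρ1.le ?_ t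
  rw [hρn]
  exact signedSumBound_cube hC C.2 (by linarith)

/-! ### Approximation of convex hulls by short averages -/

section

variable {X : Type*} [NormedAddCommGroup X] [NormedSpace ℝ X]

/-- The averages of `2 ^ t` points of `A`, repetitions allowed. -/
def dyadicAverages (A : Set X) (t : ℕ) : Set X :=
  {z | ∃ y : Fin (2 ^ t) → X, (∀ i, y i ∈ A) ∧ z = (2 ^ t : ℝ)⁻¹ • ∑ i, y i}

lemma mem_dyadicAverages_of_card {A : Set X} {t : ℕ} {ι : Type*} [Fintype ι]
    (hι : Fintype.card ι = 2 ^ t) {y : ι → X} (hy : ∀ i, y i ∈ A) :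
    (2 ^ t : ℝ)⁻¹ • ∑ i, y i ∈ dyadicAverages A t := by
  have e : Fin (2 ^ t) ≃ ι := Fintype.equivOfCardEq (by simp [hι])
  exact ⟨y ∘ e, fun i => hy _, by rw [← e.sum_comp]; rfl⟩

lemma half_add_mem_dyadicAverages {A : Set X} {t : ℕ} {a b : X} (ha : a ∈ dyadicAverages A t)
    (hb : b ∈ dyadicAverages A t) : (1 / 2 : ℝ) • (a + b) ∈ dyadicAverages A (t + 1) := by
  obtain ⟨y, hy, rfl⟩ := ha
  obtain ⟨z, hz, rfl⟩ := hb
  have h := mem_dyadicAverages_of_card (A := A) (t := t + 1) (y := Sum.elim y z)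
    (by simp [pow_succ, mul_two]) (by rintro (i | i) <;> simp [hy, hz])
  convert h using 1
  rw [Fintype.sum_sum_type, ← smul_add, smul_smul, pow_succ, mul_inv, mul_comm]
  simp

lemma dyadicAverages_mono (A : Set X) : Monotone (dyadicAverages A) := by
  refine monotone_nat_of_le_succ fun t a ha => ?_
  have h := half_add_mem_dyadicAverages ha ha
  rwa [← two_smul ℝ a, smul_smul, one_div, inv_mul_cancel₀ two_ne_zero, one_smul] at h

lemma subset_dyadicAverages_zero (A : Set X) : A ⊆ dyadicAverages A 0 :=
  fun a ha => ⟨fun _ => a, fun _ => ha, by simp⟩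

/-- A closed set of reals that contains `0`, `1` and its midpoints contains `[0,1]`. -/
lemma Icc_subset_of_isClosed_of_midpoint {I : Set ℝ} (hI : IsClosed I) (h0 : 0 ∈ I) (h1 : 1 ∈ I)
    (hm : ∀ a ∈ I, ∀ b ∈ I, (a + b) / 2 ∈ I) : Set.Icc 0 1 ⊆ I := by
  rintro t ⟨ht0, ht1⟩
  have hbP : BddAbove (I ∩ Set.Iic t) := ⟨t, fun a ha => ha.2⟩
  have hbQ : BddBelow (I ∩ Set.Ici t) := ⟨t, fun a ha => ha.2⟩
  have hP := (hI.inter isClosed_Iic).csSup_mem ⟨0, h0, ht0⟩ hbP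
  have hQ := (hI.inter isClosed_Ici).csInf_mem ⟨1, h1, ht1⟩ hbQ
  set a := sSup (I ∩ Set.Iic t)
  set b := sInf (I ∩ Set.Ici t)
  have hat : a ≤ t := hP.2
  have htb : t ≤ b := hQ.2
  -- The midpoint of the nearest points of `I` on either side of `t` cannot be nearer, so one of
  -- them is `t`.
  rcases le_total ((a + b) / 2) t with h | h
  · have : (a + b) / 2 ≤ a := le_csSup hbP ⟨hm a hP.1 b hQ.1, h⟩
    rw [show t = b by linarith]
    exact hQ.1
  · have : b ≤ (a + b) / 2 := csInf_le hbQ ⟨hm a hP.1 b hQ.1, h⟩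
    rw [show t = a by linarith]
    exact hP.1

lemma convex_of_isClosed_of_midpoint {S : Set X} (hS : IsClosed S)
    (hm : ∀ a ∈ S, ∀ b ∈ S, (1 / 2 : ℝ) • (a + b) ∈ S) : Convex ℝ S := by
  refine convex_iff_forall_pos.2 fun x hx y hy a b ha hb hab => ?_
  have hI : IsClosed {t : ℝ | (1 - t) • x + t • y ∈ S} := hS.preimage (by fun_prop)
  have h := Icc_subset_of_isClosed_of_midpoint hI (by simpa using hx) (by simpa using hy)
    (fun c hc d hd => by
      have h := hm _ hc _ hd
      simp only [Set.mem_ofPred_eq]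
      convert h using 1
      module)
    (show b ∈ Set.Icc (0 : ℝ) 1 from ⟨hb.le, by linarith⟩)
  rwa [Set.mem_ofPred_eq, show 1 - b = a by linarith] at h

/-- Dyadic averages of points of `A` are dense in the convex hull of `A`. -/
lemma convexHull_subset_closure_dyadicAverages (A : Set X) :
    convexHull ℝ A ⊆ closure (⋃ t, dyadicAverages A t) := by
  refine convexHull_min ((subset_dyadicAverages_zero A).trans
    ((Set.subset_iUnion _ 0).trans subset_closure)) ?_
  refine convex_of_isClosed_of_midpoint isClosed_closure fun a ha b hb => ?_
  refine map_mem_closure₂ (f := fun a b : X => (1 / 2 : ℝ) • (a + b)) (by fun_prop) ha hb ?_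
  intro a ha b hb
  obtain ⟨s, hs⟩ := Set.mem_iUnion.1 ha
  obtain ⟨t, ht⟩ := Set.mem_iUnion.1 hb
  exact Set.mem_iUnion.2 ⟨max s t + 1, half_add_mem_dyadicAverages
    (dyadicAverages_mono A (le_max_left s t) hs) (dyadicAverages_mono A (le_max_right s t) ht)⟩

/-- Halving: an average of `2 ^ (t + 1)` points is close to the average of half of them, chosen
one from each of `2 ^ t` pairs according to signs. -/
lemma SignedSumBound.exists_near_average_succ {t : ℕ} {b : ℝ} (h : SignedSumBound X (2 ^ t) b)
    {A : Set X} {D : ℝ} (hA : ∀ a ∈ A, ∀ a' ∈ A, ‖a - a'‖ ≤ D) {z : X}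
    (hz : z ∈ dyadicAverages A (t + 1)) : ∃ w ∈ dyadicAverages A t, ‖w - z‖ ≤ b * D / 2 := by
  obtain ⟨y, hy, rfl⟩ := hz
  have e : Fin (2 ^ t) × Bool ≃ Fin (2 ^ (t + 1)) :=
    Fintype.equivOfCardEq (by simp [pow_succ])
  obtain ⟨s, hs, hs'⟩ := h (Fin (2 ^ t)) (by simp) D
    (fun i => y (e (i, true)) - y (e (i, false))) fun i => hA _ (hy _) _ (hy _)
  refine ⟨_, mem_dyadicAverages_of_card (ι := Fin (2 ^ t)) (by simp)
    (y := fun i => if s i = 1 then y (e (i, true)) else y (e (i, false)))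
    (fun i => by split_ifs <;> exact hy _), ?_⟩
  have key : (2 ^ t : ℝ)⁻¹ • ∑ i, (if s i = 1 then y (e (i, true)) else y (e (i, false))) -
      (2 ^ (t + 1) : ℝ)⁻¹ • ∑ i, y i =
      (2 ^ (t + 1) : ℝ)⁻¹ • ∑ i, s i • (y (e (i, true)) - y (e (i, false))) := by
    have h2 : (2 ^ t : ℝ)⁻¹ = (2 ^ (t + 1) : ℝ)⁻¹ * 2 := by
      rw [pow_succ]
      field_simp
    rw [h2, mul_smul, ← smul_sub, ← e.sum_comp, Fintype.sum_prod_type, Finset.smul_sum,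
      ← Finset.sum_sub_distrib]
    congr 1
    refine Finset.sum_congr rfl fun i _ => ?_
    rw [Fintype.sum_bool]
    rcases eq_or_eq_neg_of_abs_eq (hs i) with h1 | h1
    · rw [if_pos h1, h1]
      module
    · rw [if_neg (by rw [h1]; norm_num), h1]
      module
  rw [key, norm_smul, norm_inv, norm_pow, Real.norm_ofNat, inv_mul_le_iff₀ (by positivity)]
  refine hs'.trans_eq ?_
  push_cast
  ring

/-- Iterated halving, from `2 ^ t` points down to `2 ^ s`. -/
lemma exists_near_dyadicAverage {B ρ : ℝ}
    (h : ∀ t, SignedSumBound X (2 ^ t) (2 * B * (1 - ρ) * ρ ^ t))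
    {A : Set X} {D : ℝ} (hA : ∀ a ∈ A, ∀ a' ∈ A, ‖a - a'‖ ≤ D) {s t : ℕ} (hst : s ≤ t) {z : X}
    (hz : z ∈ dyadicAverages A t) :
    ∃ w ∈ dyadicAverages A s, ‖w - z‖ ≤ B * D * (ρ ^ s - ρ ^ t) := by
  induction t, hst using Nat.le_induction generalizing z with
  | base => exact ⟨z, hz, by simp⟩
  | succ t hst ih =>
    obtain ⟨v, hv, hvz⟩ := (h t).exists_near_average_succ hA hz
    obtain ⟨w, hw, hwv⟩ := ih hv
    refine ⟨w, hw, (norm_sub_le_norm_sub_add_norm_sub w v z).trans ?_⟩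
    -- The factor `2 * B * (1 - ρ)` is chosen to make the errors telescope.
    calc ‖w - v‖ + ‖v - z‖
        ≤ B * D * (ρ ^ s - ρ ^ t) + 2 * B * (1 - ρ) * ρ ^ t * D / 2 := add_le_add hwv hvz
      _ = B * D * (ρ ^ s - ρ ^ (t + 1)) := by ring

end

/-- In a `K`-convex space, points of the convex hull of a bounded set are approximated by averages
of boundedly many points of the set, the number of points depending only on the bound for the
`K`-convexity constant, the diameter and the precision. -/
lemma exists_dyadicAverage_near_convexHull (κ : ℝ≥0) (D : ℝ) {η : ℝ} (hη : 0 < η) :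
    ∃ s : ℕ, ∀ (X : Type u) [NormedAddCommGroup X] [NormedSpace ℝ X], kConvexityConst X ≤ κ →
      ∀ A : Set X, (∀ a ∈ A, ∀ a' ∈ A, ‖a - a'‖ ≤ D) → ∀ z ∈ convexHull ℝ A,
        ∃ w ∈ dyadicAverages A s, ‖w - z‖ ≤ η := by
  obtain ⟨C, ρ, hC, hρ0, hρ1, h⟩ := exists_signedSumBound.{u} κ
  set B : ℝ := C / (2 * (1 - ρ)) with hB
  have hρ' : 0 < 1 - ρ := sub_pos.2 hρ1
  have hB0 : 0 < B := by positivity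
  have hBC : 2 * B * (1 - ρ) = C := by
    rw [hB]
    field_simp
  obtain ⟨s, hs⟩ : ∃ s : ℕ, B * D * ρ ^ s < η / 2 := by
    have := (tendsto_pow_atTop_nhds_zero_of_lt_one hρ0.le hρ1).const_mul (B * D)
    rw [mul_zero] at this
    exact (this.eventually (gt_mem_nhds (half_pos hη))).exists
  refine ⟨s, fun X _ _ hX A hA z hz => ?_⟩
  obtain ⟨a, ha⟩ := convexHull_nonempty_iff.1 ⟨z, hz⟩
  have hD : 0 ≤ D := (norm_nonneg _).trans (hA a ha a ha)
  obtain ⟨v, hv, hvz⟩ := Metric.mem_closure_iff.1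
    (convexHull_subset_closure_dyadicAverages A hz) (η / 2) (half_pos hη)
  obtain ⟨t, ht⟩ := Set.mem_iUnion.1 hv
  -- Halving needs an exponent at least `s`; repeating points raises `t` if necessary.
  obtain ⟨w, hw, hwv⟩ := exists_near_dyadicAverage (B := B) (ρ := ρ)
    (fun t => by rw [hBC]; exact h X hX t) hA (le_max_right t s)
    (dyadicAverages_mono A (le_max_left t s) ht)
  refine ⟨w, hw, ?_⟩
  have h1 := norm_sub_le_norm_sub_add_norm_sub w v z
  have h2 : 0 ≤ B * D * ρ ^ max t s := by positivity
  rw [dist_comm, dist_eq_norm] at hvz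
  nlinarith

/-! ### Comparison of packing numbers -/

section

variable {X : Type*} [NormedAddCommGroup X] [NormedSpace ℝ X]

/-- If no convexly separated sequence in `K` is longer than `x`, then every translate
`a + int B`, `a ∈ K`, meets the convex hull of `x`. -/
lemma IsConvexlySeparated.inter_convexHull_nonempty {K B : Set X} {N : ℕ} {x : Fin N → X}
    (hxK : ∀ j, x j ∈ K) (hx : IsConvexlySeparated B x)
    (hmax : convPackNum K B ≤ N) {a : X} (ha : a ∈ K) :
    ((a +ᵥ interior B) ∩ convexHull ℝ (Set.range x)).Nonempty := by
  by_contra hcon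
  rw [Set.not_nonempty_iff_eq_empty] at hcon
  have hlong : ((N + 1 : ℕ) : ℕ∞) ≤ convPackNum K B := by
    refine le_iSup₂_of_le (f := fun (N : ℕ) (_ : ∃ x : Fin N → X,
      (∀ j, x j ∈ K) ∧ IsConvexlySeparated B x) => (N : ℕ∞)) (N + 1)
      ⟨Fin.snoc (α := fun _ => X) x a, ?_, ?_⟩ le_rfl
    · refine Fin.lastCases ?_ fun j => ?_
      · simpa using ha
      · simpa using hxK j
    · refine Fin.lastCases ?_ fun j => ?_
      · rw [Fin.snoc_last]
        refine Set.subset_eq_empty (Set.inter_subset_inter_right _ (convexHull_mono ?_)) hcon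
        rintro _ ⟨i, hi, rfl⟩
        obtain ⟨i, rfl⟩ := Fin.exists_castSucc_eq.2 hi.ne
        exact ⟨i, by simp⟩
      · rw [Fin.snoc_castSucc]
        refine Set.subset_eq_empty (Set.inter_subset_inter_right _ (convexHull_mono ?_)) (hx j)
        rintro _ ⟨i, hi, rfl⟩
        obtain ⟨i, rfl⟩ := Fin.exists_castSucc_eq.2 (hi.trans (Fin.castSucc_lt_last j)).ne
        exact ⟨i, by simpa using hi, by simp⟩
  have := hlong.trans hmax
  rw [Nat.cast_le] at this
  omega

lemma exists_isConvexlySeparated_of_ne_top {K B : Set X} (h : convPackNum K B ≠ ⊤) :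
    ∃ (N : ℕ) (x : Fin N → X), (∀ j, x j ∈ K) ∧ IsConvexlySeparated B x ∧
      convPackNum K B = N := by
  have : Nonempty {N : ℕ // ∃ x : Fin N → X, (∀ j, x j ∈ K) ∧ IsConvexlySeparated B x} :=
    ⟨0, fun i => i.elim0, fun i => i.elim0, fun i => i.elim0⟩
  have heq : convPackNum K B = ⨆ N : {N : ℕ // ∃ x : Fin N → X,
      (∀ j, x j ∈ K) ∧ IsConvexlySeparated B x}, ((N : ℕ) : ℕ∞) := iSup_subtype'
  obtain ⟨⟨N, x, hxK, hx⟩, hN⟩ := ENat.exists_eq_iSup_of_lt_top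
    (f := fun N : {N : ℕ // ∃ x : Fin N → X, (∀ j, x j ∈ K) ∧ IsConvexlySeparated B x} =>
      ((N : ℕ) : ℕ∞)) (by rw [← heq]; exact lt_top_iff_ne_top.2 h)
  exact ⟨N, x, hxK, hx, heq.trans hN.symm⟩

/-- The left side is open and lies in `U/2 + U/2 = U` by convexity. -/
lemma interior_half_add_half_subset {U : Set X} (hU : Convex ℝ U) :
    interior ((1 / 2 : ℝ) • U) + (1 / 2 : ℝ) • U ⊆ interior U := by
  refine interior_maximal ?_ isOpen_interior.add_right
  refine (Set.add_subset_add_right interior_subset).trans ?_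
  rw [← hU.add_smul (by norm_num) (by norm_num)]
  norm_num

/-- If averages of `2 ^ s` points approximate convex hulls in `K` up to an element of `U / 2`, then
`M(K, U)` is polynomially bounded by `M̂(K, U / 2)`. -/
lemma packNum_le_convPackNum_pow {K U : Set X} (hU : Convex ℝ U) {s : ℕ}
    (h : ∀ A ⊆ K, ∀ z ∈ convexHull ℝ A, ∃ w ∈ dyadicAverages A s, w - z ∈ (1 / 2 : ℝ) • U) :
    packNum K U ≤ convPackNum K ((1 / 2 : ℝ) • U) ^ 2 ^ s := by
  by_cases htop : convPackNum K ((1 / 2 : ℝ) • U) = ⊤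
  · rw [htop, ENat.top_pow (by positivity)]
    exact le_top
  obtain ⟨N, x, hxK, hx, hN⟩ := exists_isConvexlySeparated_of_ne_top htop
  have hcode : ∀ a ∈ K, ∃ g : Fin (2 ^ s) → Fin N,
      (2 ^ s : ℝ)⁻¹ • ∑ i, x (g i) ∈ a +ᵥ interior U := by
    intro a ha
    obtain ⟨z, hza, hz⟩ := hx.inter_convexHull_nonempty hxK hN.le ha
    obtain ⟨w, ⟨y, hy, rfl⟩, hw⟩ := h _ (Set.range_subset_iff.2 hxK) z hz
    choose g hg using hy
    refine ⟨g, ?_⟩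
    simp only [hg]
    rw [Set.mem_vadd_set_iff_neg_vadd_mem, vadd_eq_add] at hza ⊢
    refine interior_half_add_half_subset hU ?_
    convert Set.add_mem_add hza hw using 1
    abel
  choose g hg using hcode
  rw [hN]
  refine iSup_le fun S => iSup₂_le fun hSK hS => ?_
  -- Equal codes give one average lying in both translates.
  have hinj : Function.Injective fun a : S => g a (hSK a.2) := by
    intro a b hab
    dsimp only at hab
    by_contra hne
    refine Set.disjoint_left.1 (hS a.2 b.2 (Subtype.coe_ne_coe.2 hne)) (hg a (hSK a.2)) ?_
    rw [hab]
    exact hg b (hSK b.2)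
  refine (ENat.card_le_card_of_injective hinj).trans_eq ?_
  rw [ENat.card_eq_coe_fintype_card]
  simp

lemma log₂_le_mul_log₂ {m n : ℕ∞} {q : ℕ} (h : m ≤ n ^ q) :
    log₂ m ≤ (((q : ℕ) : ℝ) : EReal) * log₂ n := by
  have hlog : (0 : EReal) ≤ ((Real.log 2 : ℝ) : EReal) :=
    EReal.coe_nonneg.2 (Real.log_nonneg one_le_two)
  rw [log₂, log₂, EReal.mul_div]
  refine EReal.div_le_div_right_of_nonneg hlog ?_
  have h1 : (m : ℝ≥0∞) ≤ (n : ℝ≥0∞) ^ q := by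
    rw [← ENat.toENNReal_pow]
    exact ENat.toENNReal_le.2 h
  refine (ENNReal.log_monotone h1).trans_eq ?_
  rw [ENNReal.log_pow]
  norm_cast

end

/-- For `K` of diameter at most `D` and `U ⊇ rB` convex, `log M(K, U)` is bounded by
`log M̂(K, U / 2)` up to a factor that depends only on `D`, `r` and the bound for the
`K`-convexity constant. -/
lemma exists_log₂_packNum_le (κ : ℝ≥0) (D r : ℝ) :
    ∃ β : ℝ, 0 < β ∧ (0 < r →
      ∀ (X : Type u) [NormedAddCommGroup X] [NormedSpace ℝ X], kConvexityConst X ≤ κ →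
        ∀ K U : Set X, (∀ a ∈ K, ∀ a' ∈ K, ‖a - a'‖ ≤ D) → Convex ℝ U →
          r • Metric.closedBall (0 : X) 1 ⊆ U →
            log₂ (packNum K U) ≤ (β : EReal) * log₂ (convPackNum K ((1 / 2 : ℝ) • U))) := by
  by_cases hr : 0 < r
  swap
  -- A dummy value, so that `β` is a total function of `κ`, `D`, `r`.
  · exact ⟨1, one_pos, fun h => absurd h hr⟩
  obtain ⟨s, hs⟩ := exists_dyadicAverage_near_convexHull.{u} κ D (half_pos hr)
  refine ⟨((2 ^ s : ℕ) : ℝ), by positivity, fun _ X _ _ hX K U hK hU hrU => ?_⟩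
  refine log₂_le_mul_log₂ (packNum_le_convPackNum_pow hU fun A hA z hz => ?_)
  obtain ⟨w, hw, hwz⟩ := hs X hX A (fun a ha a' ha' => hK a (hA ha) a' (hA ha')) z hz
  refine ⟨w, hw, Set.smul_set_mono hrU ?_⟩
  rw [smul_smul, smul_closedBall _ _ zero_le_one, smul_zero, mem_closedBall_zero_iff,
    Real.norm_of_nonneg (by positivity)]
  linarith

theorem mainTheorem3 :
    (∃ β : ℝ≥0 → ℝ → ℝ, (∀ κ d, 0 < β κ d) ∧
      ∀ (X : Type u) [NormedAddCommGroup X] [NormedSpace ℝ X] (κ : ℝ≥0),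
        kConvexityConst X ≤ κ →
        ∀ T : Set X, Bornology.IsBounded T →
          log₂ (packNum T (Metric.closedBall 0 1)) ≤
            (β κ (Metric.diam T) : EReal) *
              log₂ (convPackNum T ((1 / 2 : ℝ) • Metric.closedBall (0 : X) 1))) ∧
    (∃ β' : ℝ≥0 → ℝ → ℝ, (∀ κ r, 0 < β' κ r) ∧
      ∀ (X : Type u) [NormedAddCommGroup X] [NormedSpace ℝ X] (κ : ℝ≥0),
        kConvexityConst X ≤ κ →
        ∀ (r : ℝ), 0 < r →
        ∀ U : Set X, Convex ℝ U → (∀ x ∈ U, -x ∈ U) → r • Metric.closedBall (0 : X) 1 ⊆ U →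
          log₂ (packNum (Metric.closedBall 0 1) U) ≤
            (β' κ r : EReal) *
              log₂ (convPackNum (Metric.closedBall 0 1) ((1 / 2 : ℝ) • U))) := by
  choose β hβ h using exists_log₂_packNum_le.{u}
  refine ⟨⟨fun κ d => β κ d 1, fun κ d => hβ κ d 1, fun X _ _ κ hX T hT => ?_⟩,
    ⟨fun κ r => β κ 2 r, fun κ r => hβ κ 2 r, fun X _ _ κ hX r hr U hU _ hrU => ?_⟩⟩
  · refine h κ _ 1 one_pos X hX T _ (fun a ha a' ha' => ?_) (convex_closedBall 0 1)
      (one_smul ℝ (Metric.closedBall (0 : X) 1)).subset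
    rw [← dist_eq_norm]
    exact Metric.dist_le_diam_of_mem hT ha ha'
  · refine h κ 2 r hr X hX _ U (fun a ha a' ha' => ?_) hU hrU
    rw [mem_closedBall_zero_iff] at ha ha'
    linarith [norm_sub_le a a']
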